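/- Let $V:[0,\infty)\to(-\infty,+\infty]$ be such that $x\mapsto V(|x|)$ is measurable on $\mathbb{R}^d$. Call $V$ \emph{stable} if there is $B\ge 0$ with $$\sum_{1\le i<j\le N}V(|x_i-x_j|)\ge -BN\qquad\text{for all }N\in\mathbb{N},\ (x_1,\dots,x_N)\in(\mathbb{R}^d)^N,$$ and call the infimum of such $B$ the \emph{stability constant} of $V$. Call $V$ \emph{tempered} if $\int_{|x|\ge r_0}|V(|x|)|\,dx<\infty$ for some $r_0\ge 0$. A \emph{Penrose potential} with hard-core radius $a>0$ is a stable and tempered $V$ such that $V(r)=+\infty$ for $r\le a$ and $V(r)<0$ for $r>a$. For $\beta>0$, a cubic box $\Lambda\subset\mathbb{R}^d$ of volume $|\Lambda|>0$ and $n\ge 1$, let $$C_n(\beta,\Lambda)=\frac{1}{|\Lambda|}\frac{1}{n!}\int_{\Lambda}dx_1\cdots\int_{\Lambda}dx_n\sum_{g\in G_n}\ \prod_{\{i,j\}\in E_g}\left[e^{-\beta V(|x_i-x_j|)}-1\right]$$ be the $n$-th order Mayer coefficient, where $G_n$ is the set of connected graphs with vertex set $\{1,\dots,n\}$ and $E_g$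 is the edge set of $g$ (so $C_1(\beta,\Lambda)=1$). \textbf{Theorem.} Let $V$ be a Penrose potential with hard-core radius $a$ and stability constant $B$, let $\beta>0$, and let $$C^*(\beta)=W_a(d)+\beta\int_{|x|\ge a}|V(|x|)|\,dx ,$$ where $W_a(d)$ is the volume of the ball of radius $a$ in $\mathbb{R}^d$. Then $C^*(\beta)<\infty$ and, for every cubic box $\Lambda$ and every $n\ge 1$, the integral defining $C_n(\beta,\Lambda)$ converges absolutely and $$|C_n(\beta,\Lambda)|\le e^{\beta Bn}\,n^{n-2}\,\frac{[C^*(\beta)]^{n-1}}{n!}.$$ Consequently, the Mayer series $\sum_{n\ge 1}C_n(\beta,\Lambda)\lambda^n$ converges absolutely for every complex $\lambda$ with $$|\lambda|<\frac{1}{e^{\beta B+1}\,C^*(\beta)}.$$ -/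

import Mathlib

open scoped NNReal ENNReal

noncomputable section

namespace Gas

/-- The space `ℝ^d` with its Euclidean norm and Lebesgue measure. -/
abbrev Space (d : ℕ) : Type := EuclideanSpace ℝ (Fin d)

/-- The pairs `i < j` of labels of `N` particles. -/
def pairs (N : ℕ) : Finset (Fin N × Fin N) :=
  Finset.univ.filter fun p => p.1 < p.2

/-- A pair potential `V : [0,∞) → (-∞,+∞]`, with `x ↦ V(|x|)` Lebesgue measurable on `ℝ^d`. -/
structure IsPairPotential (d : ℕ) (V : ℝ≥0 → EReal) : Prop where
  ne_bot : ∀ r, V r ≠ ⊥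
  aemeasurable : AEMeasurable (fun x : Space d => V ‖x‖₊) MeasureTheory.volume

/-- The configurational energy `U(x_1,…,x_N)`, with values in `(-∞,+∞]`. -/
def energy {d : ℕ} (V : ℝ≥0 → EReal) {N : ℕ} (x : Fin N → Space d) : EReal :=
  ∑ p ∈ pairs N, V ‖x p.1 - x p.2‖₊

/-- The number `B ≥ 0` satisfies the stability inequality `U(x_1,…,x_N) ≥ -B N`. -/
def StableWith (d : ℕ) (V : ℝ≥0 → EReal) (B : ℝ) : Prop :=
  0 ≤ B ∧ ∀ (N : ℕ) (x : Fin N → Space d), ((-(B * N) : ℝ) : EReal) ≤ energy V x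

def IsStable (d : ℕ) (V : ℝ≥0 → EReal) : Prop :=
  ∃ B : ℝ, StableWith d V B

/-- The stability constant: the infimum of the admissible `B`. -/
def stabilityConstant (d : ℕ) (V : ℝ≥0 → EReal) : ℝ :=
  sInf {B : ℝ | StableWith d V B}

/-- The integral of `|V(|x|)|` over `|x| ≥ r`, with values in `[0,+∞]`. -/
def tailIntegral (d : ℕ) (V : ℝ≥0 → EReal) (r : ℝ) : ℝ≥0∞ :=
  ∫⁻ x in {x : Space d | r ≤ ‖x‖}, (V ‖x‖₊).abs

def IsTempered (d : ℕ) (V : ℝ≥0 → EReal) : Prop :=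
  ∃ r₀ : ℝ, 0 ≤ r₀ ∧ tailIntegral d V r₀ < ⊤

/-- An admissible (stable and tempered) pair potential. -/
structure IsAdmissible (d : ℕ) (V : ℝ≥0 → EReal) : Prop where
  isPairPotential : IsPairPotential d V
  stable : IsStable d V
  tempered : IsTempered d V

/-- A Penrose potential with hard-core radius `a`. -/
structure IsPenrose (d : ℕ) (V : ℝ≥0 → EReal) (a : ℝ) : Prop where
  admissible : IsAdmissible d V
  radius_pos : 0 < a
  hard_core : ∀ r : ℝ≥0, (r : ℝ) ≤ a → V r = ⊤
  negative_tail : ∀ r : ℝ≥0, a < r → V r < 0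

/-- The Mayer function `e^{-β V(r)} - 1` (equal to `-1` where `V(r) = +∞`, for `β > 0`). -/
def mayerFunction (β : ℝ) (V : ℝ≥0 → EReal) (r : ℝ≥0) : ℝ :=
  (EReal.exp (-((β : EReal) * V r))).toReal - 1

open Classical in
/-- The sum over the connected graphs `g` on `n` labelled vertices of the product over the edges
`{i,j}` of `g` (listed with `i < j`) of `e^{-β V(|x_i - x_j|)} - 1`. -/
def ursell {d : ℕ} (β : ℝ) (V : ℝ≥0 → EReal) (n : ℕ) (x : Fin n → Space d) : ℝ :=
  ∑ g ∈ Finset.univ.filter (fun g : SimpleGraph (Fin n) => g.Connected),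
    ∏ p ∈ (pairs n).filter (fun p => g.Adj p.1 p.2), mayerFunction β V ‖x p.1 - x p.2‖₊

/-- The cubic box with corner `c` and side length `L`. -/
def box {d : ℕ} (c : Space d) (L : ℝ) : Set (Space d) :=
  {x | ∀ i, c i ≤ x i ∧ x i ≤ c i + L}

/-- The set `Λ^n` of configurations of `n` particles in `Λ`. -/
def configurations {d : ℕ} (Λ : Set (Space d)) (n : ℕ) : Set (Fin n → Space d) :=
  {x | ∀ i, x i ∈ Λ}

/-- The Mayer coefficient `C_n(β,Λ)`, `n ≥ 1`. For `n = 1` the only graph has no edge and the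
value is `1` as soon as `0 < |Λ| < ∞`. -/
def mayerCoeff {d : ℕ} (β : ℝ) (V : ℝ≥0 → EReal) (Λ : Set (Space d)) (n : ℕ) : ℝ :=
  (1 / MeasureTheory.volume.real Λ) * (1 / (n.factorial : ℝ)) *
    ∫ x in configurations Λ n, ursell β V n x

/-- `C*(β) = W_a(d) + β ∫_{|x| ≥ a} |V(|x|)| dx`, where `W_a(d)` is the volume of a ball of
radius `a` in `ℝ^d`. -/
def cStar (d : ℕ) (V : ℝ≥0 → EReal) (a β : ℝ) : ℝ :=
  MeasureTheory.volume.real (Metric.closedBall (0 : Space d) a) + β * (tailIntegral d V a).toReal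

end Gas

end

open scoped NNReal ENNReal

noncomputable section

namespace Gas

/-! ### Sums over connected graphs and over trees: the tree-graph inequality. -/

section GraphSums

open SimpleGraph

variable {α : Type*}

/-! The sum over connected graphs is dominated pointwise by a sum over trees, with weight 1 on pairs
at distance at most a and 1 - e^{-β|V|} on the others, times the single stability factor e^{βBn}.
Integrating a tree edge by edge then gives at most C*(β) per edge, and there are at most n^{n-2}
trees.

The tree bound (`abs_graphSum_connected_mul_le`) comes from deciding the pairs one at a time,
attractive ones before hard ones, while keeping the forest G of accepted edges. A pair already
joined by G does not affect connectivity, so summing over its two options gives the factor 1 + f =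
e^{-u}; a pair not joined by G is either rejected or added to the forest with factor f = (1 - e^{u})
e^{-u}. In both cases an e^{-u} is left only for a pair inside a component of G. When the hard pairs
come up, one of them inside a component makes the sum vanish, because there 1 + f = 0. Otherwise
each component is a configuration without hard overlaps, and stability on the components bounds the
product of all the e^{-u} by e^{βBn}. Spending stability only once, at this point, is what yields
e^{βBn}.

Trees are encoded by parent maps towards a root (`graphSum_isTree_le`), counted by a Cayley-type
recursion (`card_parentMaps_le`) and integrated from the leaves inwards by translation invariance
(`lmarginal_mul_prod_sub`). The inequality 1 - e^{-t} ≤ t turns the edge integral into C*(β). -/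

theorem _root_.SimpleGraph.Reachable.of_forall_adj {G H : SimpleGraph α}
    (h : ∀ a b, H.Adj a b → G.Reachable a b) {a b : α} (hab : H.Reachable a b) :
    G.Reachable a b := by
  obtain ⟨w⟩ := hab
  induction w with
  | nil => exact Reachable.refl _
  | cons hadj _ ih => exact (h _ _ hadj).trans ih

theorem _root_.SimpleGraph.Reachable.connected_sup_edge_iff {G : SimpleGraph α} {u v : α}
    (h : G.Reachable u v) : (G ⊔ edge u v).Connected ↔ G.Connected := by
  refine ⟨fun hc => ?_, fun hc => hc.mono le_sup_left⟩
  have := hc.nonempty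
  refine Connected.mk fun a b => Reachable.of_forall_adj (fun a b hab => ?_) (hc.preconnected a b)
  rw [sup_adj, edge_adj] at hab
  rcases hab with hab | ⟨⟨rfl, rfl⟩ | ⟨rfl, rfl⟩, -⟩
  · exact hab.reachable
  · exact h
  · exact h.symm

/-- The graph obtained from `G` by adding the edges of `S`. -/
def addEdges (G : SimpleGraph α) (S : Finset (α × α)) : SimpleGraph α :=
  G ⊔ ⨆ p ∈ S, edge p.1 p.2

theorem addEdges_empty (G : SimpleGraph α) : addEdges G ∅ = G := by
  simp [addEdges]

theorem addEdges_insert [DecidableEq α] (G : SimpleGraph α) (e : α × α) (S : Finset (α × α)) :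
    addEdges G (insert e S) = addEdges (G ⊔ edge e.1 e.2) S := by
  rw [addEdges, addEdges, Finset.iSup_insert, sup_assoc]

theorem le_addEdges (G : SimpleGraph α) (S : Finset (α × α)) : G ≤ addEdges G S := le_sup_left

theorem addEdges_sup_edge (G : SimpleGraph α) (e : α × α) (S : Finset (α × α)) :
    addEdges (G ⊔ edge e.1 e.2) S = addEdges G S ⊔ edge e.1 e.2 := by
  exact sup_right_comm _ _ _

open Classical in
/-- The sum of `∏ e ∈ S, f e` over the sets of edges `S ⊆ E` for which `G + S` satisfies `P`. -/
def graphSum (P : SimpleGraph α → Prop) (f : α × α → ℝ) (G : SimpleGraph α)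
    (E : Finset (α × α)) : ℝ :=
  ∑ S ∈ E.powerset, if P (addEdges G S) then ∏ e ∈ S, f e else 0

open Classical in
theorem graphSum_insert (P : SimpleGraph α → Prop) (f : α × α → ℝ) (G : SimpleGraph α)
    {E : Finset (α × α)} {e : α × α} (he : e ∉ E) :
    graphSum P f G (insert e E) = graphSum P f G E + f e * graphSum P f (G ⊔ edge e.1 e.2) E := by
  rw [graphSum, Finset.sum_powerset_insert he, graphSum, graphSum, Finset.mul_sum]
  congr 1
  refine Finset.sum_congr rfl fun S hS => ?_
  have heS : e ∉ S := fun h => he (Finset.mem_powerset.1 hS h)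
  rw [addEdges_insert, Finset.prod_insert heS, mul_ite, mul_zero]

theorem graphSum_eq_sum_filter (P : SimpleGraph α → Prop) (f : α × α → ℝ) (G : SimpleGraph α)
    (E : Finset (α × α)) [DecidablePred fun S => P (addEdges G S)] :
    graphSum P f G E = ∑ S ∈ E.powerset with P (addEdges G S), ∏ e ∈ S, f e := by
  rw [graphSum, Finset.sum_filter]
  congr!

theorem graphSum_nonneg {P : SimpleGraph α → Prop} {f : α × α → ℝ} {G : SimpleGraph α}
    {E : Finset (α × α)} (hf : ∀ e ∈ E, 0 ≤ f e) : 0 ≤ graphSum P f G E := by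
  refine Finset.sum_nonneg fun S hS => ?_
  split_ifs
  · exact Finset.prod_nonneg fun e he => hf e (Finset.mem_powerset.1 hS he)
  · exact le_rfl

open Classical in
theorem graphSum_connected_sup_edge {f : α × α → ℝ} {G : SimpleGraph α} {E : Finset (α × α)}
    {e : α × α} (h : G.Reachable e.1 e.2) :
    graphSum Connected f (G ⊔ edge e.1 e.2) E = graphSum Connected f G E := by
  refine Finset.sum_congr rfl fun S _ => ?_
  rw [addEdges_sup_edge]
  congr 1
  exact propext (h.mono (le_addEdges G S)).connected_sup_edge_iff

open Classical in
-- Connectivity does not depend on whether `e` is chosen, so its two options factor out of the sum.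
theorem graphSum_connected_insert_of_reachable {f : α × α → ℝ} {G : SimpleGraph α}
    {E : Finset (α × α)} {e : α × α} (he : e ∉ E) (h : G.Reachable e.1 e.2) :
    graphSum Connected f G (insert e E) = (1 + f e) * graphSum Connected f G E := by
  rw [graphSum_insert _ _ _ he, graphSum_connected_sup_edge h]
  ring

open Classical in
-- Choosing and not choosing `e` cancel exactly. This is how a hard-core overlap inside a component
-- removes a configuration for which stability would say nothing.
theorem graphSum_connected_eq_zero {f : α × α → ℝ} {G : SimpleGraph α}
    {E : Finset (α × α)} {e : α × α} (he : e ∈ E) (hf : f e = -1) (h : G.Reachable e.1 e.2) :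
    graphSum Connected f G E = 0 := by
  rw [← Finset.insert_erase he,
    graphSum_connected_insert_of_reachable (Finset.notMem_erase e E) h, hf]
  ring

open Classical in
theorem graphSum_empty (P : SimpleGraph α → Prop) (f : α × α → ℝ) (G : SimpleGraph α) :
    graphSum P f G ∅ = if P G then 1 else 0 := by
  simp [graphSum, addEdges_empty]

open Classical in
-- The recursion without attraction: a pair joined by `G` kills the sum, any other pair keeps `G` a
-- forest. Hence the only terms that survive to the end are trees, each of modulus 1.
theorem abs_graphSum_connected_le_of_hard {f w : α × α → ℝ} {H : Finset (α × α)}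
    (hf : ∀ e ∈ H, f e = -1) (hw : ∀ e ∈ H, w e = 1) {G : SimpleGraph α} (hG : G.IsAcyclic) :
    |graphSum Connected f G H| ≤ graphSum IsTree w G H := by
  induction H using Finset.induction_on generalizing G with
  | empty =>
    rw [graphSum_empty, graphSum_empty]
    by_cases h : G.Connected
    · simp [h, show G.IsTree from ⟨h, hG⟩]
    · have h' : ¬ G.IsTree := fun ht => h ht.connected
      simp [h, h']
  | insert e E he ih =>
    have ih' := @ih (fun e h => hf e (Finset.mem_insert_of_mem h))
      (fun e h => hw e (Finset.mem_insert_of_mem h))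
    by_cases hr : G.Reachable e.1 e.2
    · rw [graphSum_connected_eq_zero (Finset.mem_insert_self e E)
        (hf e (Finset.mem_insert_self e E)) hr, abs_zero]
      exact graphSum_nonneg fun e he => by rw [hw e he]; exact zero_le_one
    · rw [graphSum_insert _ _ _ he, graphSum_insert _ _ _ he, hf e (Finset.mem_insert_self e E),
        hw e (Finset.mem_insert_self e E), one_mul]
      refine (abs_add_le _ _).trans (add_le_add (ih' hG) ?_)
      rw [neg_one_mul, abs_neg]
      exact ih' (hG.sup_edge_of_not_reachable hr)

open Classical in
-- Stability is applied to each connected component of `G`; the component sizes add up to the number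
-- of vertices.
theorem sum_reachable_ge [Fintype α] {A H : Finset (α × α)} {u : α × α → ℝ} {b : ℝ}
    (hstab : ∀ S : Finset α, (∀ p ∈ H, ¬ (p.1 ∈ S ∧ p.2 ∈ S)) →
      -(b * S.card) ≤ ∑ p ∈ A with p.1 ∈ S ∧ p.2 ∈ S, u p)
    {G : SimpleGraph α} (hG : ∀ p ∈ H, ¬ G.Reachable p.1 p.2) :
    -(b * Fintype.card α) ≤ ∑ p ∈ A with G.Reachable p.1 p.2, u p := by
  let : DecidableEq G.ConnectedComponent := Classical.decEq _
  have key : ∀ c : G.ConnectedComponent,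
      -(b * (Finset.univ.filter fun a => G.connectedComponentMk a = c).card) ≤
        ∑ p ∈ (A.filter fun p => G.Reachable p.1 p.2) with G.connectedComponentMk p.1 = c, u p := by
    intro c
    have := hstab (Finset.univ.filter fun a => G.connectedComponentMk a = c) ?_
    · refine this.trans_eq (Finset.sum_congr ?_ fun _ _ => rfl)
      ext p
      simp only [Finset.mem_filter, Finset.mem_univ, true_and, ← ConnectedComponent.eq]
      constructor
      · rintro ⟨h, h1, h2⟩
        exact ⟨⟨h, h1.trans h2.symm⟩, h1⟩
      · rintro ⟨⟨h, h1⟩, h2⟩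
        exact ⟨h, h2, h1 ▸ h2⟩
    · rintro p hp ⟨h1, h2⟩
      simp only [Finset.mem_filter, Finset.mem_univ, true_and] at h1 h2
      exact hG p hp (ConnectedComponent.exact (h1.trans h2.symm))
  have hsum := Finset.sum_le_sum fun c (_ : c ∈ Finset.univ) => key c
  rw [Finset.sum_fiberwise] at hsum
  refine le_trans (le_of_eq ?_) hsum
  rw [Finset.sum_neg_distrib, ← Finset.mul_sum, ← Nat.cast_sum,
    ← Finset.card_eq_sum_card_fiberwise (fun _ _ => Finset.mem_coe.2 (Finset.mem_univ _)),
    Finset.card_univ]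

open Classical in
-- The inductive form of the tree-graph inequality: `R` holds the attractive pairs still to be
-- decided, `P` those already decided. The product on the left stores the factors e^{-u} of the
-- decided pairs lying inside components of `G`, to be paid for by stability once `R` is exhausted.
theorem abs_graphSum_connected_mul_le [Fintype α] {A H : Finset (α × α)} (hAH : Disjoint A H)
    {u f w : α × α → ℝ} {b : ℝ}
    (hu : ∀ e ∈ A, u e ≤ 0) (hfA : ∀ e ∈ A, f e = Real.exp (-u e) - 1)
    (hwA : ∀ e ∈ A, w e = 1 - Real.exp (u e))
    (hfH : ∀ e ∈ H, f e = -1) (hwH : ∀ e ∈ H, w e = 1)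
    (hstab : ∀ S : Finset α, (∀ p ∈ H, ¬ (p.1 ∈ S ∧ p.2 ∈ S)) →
      -(b * S.card) ≤ ∑ p ∈ A with p.1 ∈ S ∧ p.2 ∈ S, u p)
    {R P : Finset (α × α)} (hRP : Disjoint R P) (hA : R ∪ P = A)
    {G : SimpleGraph α} (hG : G.IsAcyclic) :
    |graphSum Connected f G (R ∪ H)| * ∏ p ∈ P with G.Reachable p.1 p.2, Real.exp (-u p) ≤
      Real.exp (b * Fintype.card α) * graphSum IsTree w G (R ∪ H) := by
  have hw0 : ∀ e ∈ A ∪ H, 0 ≤ w e := by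
    intro e he
    rcases Finset.mem_union.1 he with he | he
    · rw [hwA e he, sub_nonneg, Real.exp_le_one_iff]
      exact hu e he
    · rw [hwH e he]
      exact zero_le_one
  induction R using Finset.induction_on generalizing P G with
  | empty =>
    rw [Finset.empty_union] at hA ⊢
    subst hA
    by_cases h : ∃ e ∈ H, G.Reachable e.1 e.2
    · obtain ⟨e, he, hr⟩ := h
      rw [graphSum_connected_eq_zero he (hfH e he) hr, abs_zero, zero_mul]
      exact mul_nonneg (Real.exp_nonneg _)
        (graphSum_nonneg fun e he => hw0 e (Finset.mem_union_right _ he))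
    · push Not at h
      rw [mul_comm]
      refine mul_le_mul ?_ (abs_graphSum_connected_le_of_hard hfH hwH hG) (abs_nonneg _)
        (Real.exp_nonneg _)
      rw [← Real.exp_sum, Real.exp_le_exp, Finset.sum_neg_distrib, neg_le]
      exact sum_reachable_ge hstab h
  | insert e E he ih =>
    have heA : e ∈ A := hA ▸ Finset.mem_union_left _ (Finset.mem_insert_self e E)
    have heP : e ∉ P := Finset.disjoint_left.1 hRP (Finset.mem_insert_self e E)
    have heH : e ∉ H := Finset.disjoint_left.1 hAH heA
    have heE : e ∉ E ∪ H := by simp [he, heH]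
    -- Deciding `e` moves it from the undecided pairs to the decided ones.
    have ih' := fun (G : SimpleGraph α) (hG : G.IsAcyclic) => @ih (insert e P)
      (Finset.disjoint_insert_right.2 ⟨he, hRP.mono_left (Finset.subset_insert e E)⟩)
      (by rw [Finset.union_insert, ← hA, Finset.insert_union]) G hG
    have hT : ∀ G, 0 ≤ graphSum IsTree w G (E ∪ H) := fun G => graphSum_nonneg fun x hx => by
      refine hw0 x ?_
      rw [← hA]
      refine Finset.union_subset_union_left ?_ hx
      exact (Finset.subset_insert e E).trans Finset.subset_union_left
    have hwe : 0 ≤ w e := hw0 e (Finset.mem_union_left _ heA)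
    rw [Finset.insert_union]
    by_cases hr : G.Reachable e.1 e.2
    · rw [graphSum_connected_insert_of_reachable heE hr, graphSum_insert _ _ _ heE, hfA e heA,
        add_sub_cancel, abs_mul, Real.abs_exp]
      have h1 := ih' G hG
      rw [Finset.filter_insert, if_pos hr, Finset.prod_insert (by simp [heP])] at h1
      refine le_trans (le_of_eq (by ring)) (h1.trans ?_)
      exact mul_le_mul_of_nonneg_left (le_add_of_nonneg_right (mul_nonneg hwe (hT _)))
        (Real.exp_nonneg _)
    · rw [graphSum_insert _ _ _ heE, graphSum_insert _ _ _ heE, mul_add]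
      have h1 := ih' G hG
      rw [Finset.filter_insert, if_neg hr] at h1
      have hr' : (G ⊔ edge e.1 e.2).Reachable e.1 e.2 := by
        have hne : e.1 ≠ e.2 := fun h => hr (h ▸ Reachable.refl _)
        exact Adj.reachable (by simp [edge_adj, hne])
      have h2 := ih' _ (hG.sup_edge_of_not_reachable hr)
      rw [Finset.filter_insert, if_pos hr', Finset.prod_insert (by simp [heP])] at h2
      -- The factor e^{-u} split off here is the one that `e` contributes to the stored product for
      -- `G + e`, where its ends are joined.
      have hfe : f e = w e * Real.exp (-u e) := by
        rw [hfA e heA, hwA e heA, sub_mul, one_mul, ← Real.exp_add, add_neg_cancel, Real.exp_zero]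
      -- Merging two components only adds factors e^{-u} ≥ 1 to the stored product.
      have hprod : ∏ p ∈ P with G.Reachable p.1 p.2, Real.exp (-u p) ≤
          ∏ p ∈ P with (G ⊔ edge e.1 e.2).Reachable p.1 p.2, Real.exp (-u p) := by
        refine Finset.prod_le_prod_of_subset_of_one_le ?_ (fun _ _ => Real.exp_nonneg _) ?_
        · intro p hp
          rw [Finset.mem_filter] at hp ⊢
          exact ⟨hp.1, hp.2.mono le_sup_left⟩
        · intro p hp _
          refine Real.one_le_exp (neg_nonneg.2 (hu p ?_))
          exact (hA ▸ Finset.mem_union_right _ (Finset.mem_filter.1 hp).1)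
      refine (mul_le_mul_of_nonneg_right (abs_add_le _ _)
        (Finset.prod_nonneg fun _ _ => Real.exp_nonneg _)).trans ?_
      rw [add_mul]
      refine add_le_add h1 ?_
      rw [abs_mul, hfe, abs_of_nonneg (mul_nonneg hwe (Real.exp_nonneg _))]
      refine le_trans ?_ (le_trans (mul_le_mul_of_nonneg_left h2 hwe) (le_of_eq (by ring)))
      refine le_trans (mul_le_mul_of_nonneg_left hprod
        (mul_nonneg (mul_nonneg hwe (Real.exp_nonneg _)) (abs_nonneg _))) (le_of_eq ?_)
      ring_nf
      congr!

/-- The tree-graph inequality for a system with hard pairs `H` and attractive pairs `A`. -/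
theorem abs_graphSum_connected_le [Fintype α] {A H : Finset (α × α)} [DecidableEq α]
    (hAH : Disjoint A H)
    {u f w : α × α → ℝ} {b : ℝ}
    (hu : ∀ e ∈ A, u e ≤ 0) (hfA : ∀ e ∈ A, f e = Real.exp (-u e) - 1)
    (hwA : ∀ e ∈ A, w e = 1 - Real.exp (u e))
    (hfH : ∀ e ∈ H, f e = -1) (hwH : ∀ e ∈ H, w e = 1)
    (hstab : ∀ S : Finset α, (∀ p ∈ H, ¬ (p.1 ∈ S ∧ p.2 ∈ S)) →
      -(b * S.card) ≤ ∑ p ∈ A with p.1 ∈ S ∧ p.2 ∈ S, u p) :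
    |graphSum Connected f ⊥ (A ∪ H)| ≤
      Real.exp (b * Fintype.card α) * graphSum IsTree w ⊥ (A ∪ H) := by
  have := abs_graphSum_connected_mul_le hAH hu hfA hwA hfH hwH
    (fun S hS => (hstab S hS).trans_eq (Finset.sum_congr (by congr) fun _ _ => rfl))
    (Finset.disjoint_empty_right A)
    (by simp) (isAcyclic_bot (V := α))
  simp only [Finset.filter_empty, Finset.prod_empty, mul_one] at this
  convert! this

end GraphSums

/-! ### Counting rooted forests through their parent maps. -/

theorem sum_powerset_card_mul_pow {α : Type*} (U : Finset α) (k m : ℕ) (hU : U.card = m + 1) :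
    ∑ J ∈ U.powerset, J.card * k ^ J.card * (m + 1) ^ (U.card - J.card) =
      (m + 1) * k * (k + (m + 1)) ^ m := by
  -- This is k·d/dk applied to the binomial expansion of (k + t)^{m+1}, at t = m + 1.
  rw [Finset.sum_powerset_apply_card (fun j : ℕ => j * k ^ j * (m + 1) ^ (U.card - j)), hU,
    Finset.sum_range_succ', add_pow k, Finset.mul_sum]
  simp only [zero_mul, mul_zero, add_zero, smul_eq_mul]
  refine Finset.sum_congr rfl fun j _ => ?_
  have h := Nat.add_one_mul_choose_eq m j
  rw [show m + 1 - (j + 1) = m - j by omega, pow_succ]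
  calc (m + 1).choose (j + 1) * ((j + 1) * (k ^ j * k) * (m + 1) ^ (m - j))
      = ((m + 1).choose (j + 1) * (j + 1)) * (k ^ j * k * (m + 1) ^ (m - j)) := by ring
    _ = _ := by rw [← h, Nat.cast_id]; ring

section ParentMaps

variable {α : Type*} [DecidableEq α]

/-- The map `p` is the parent map of a forest with non-root vertices `U` and roots in `K`. -/
def IsParentMap (K U : Finset α) (p : α → α) : Prop :=
  (∀ u ∈ U, p u ∈ K ∪ U) ∧ (∀ u ∉ U, p u = u) ∧ ∃ h : α → ℕ, ∀ u ∈ U, h (p u) < h u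

open Classical in
/-- The parent maps of the forests with non-root vertices `U` and roots in `K`. -/
def parentMaps [Fintype α] (K U : Finset α) : Finset (α → α) :=
  Finset.univ.filter (IsParentMap K U)

theorem mem_parentMaps [Fintype α] {K U : Finset α} {p : α → α} :
    p ∈ parentMaps K U ↔ IsParentMap K U p := by
  simp [parentMaps]

theorem card_parentMaps_empty_le [Fintype α] (K : Finset α) : (parentMaps K ∅).card ≤ 1 := by
  refine Finset.card_le_one.2 fun p hp q hq => ?_
  rw [mem_parentMaps] at hp hq
  funext u
  rw [hp.2.1 u (Finset.notMem_empty u), hq.2.1 u (Finset.notMem_empty u)]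

theorem IsParentMap.exists_mem_root {K U : Finset α} {p : α → α} (hp : IsParentMap K U p)
    (hU : U.Nonempty) : ∃ u ∈ U, p u ∈ K := by
  obtain ⟨h1, -, h, h3⟩ := hp
  obtain ⟨u, hu, hmin⟩ := Finset.exists_min_image U h hU
  refine ⟨u, hu, (Finset.mem_union.1 (h1 u hu)).resolve_right fun hpu => ?_⟩
  exact absurd (h3 u hu) (not_lt.2 (hmin _ hpu))

/-- A forest is determined by its first generation `J` (the vertices whose parent is a root), the
parents of `J` in `K`, and the forest that remains on `U \ J` with `J` as its roots. `J` is nonempty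
because a vertex of least height has its parent in `K`. -/
theorem parentMaps_subset [Fintype α] {K U : Finset α} (hU : U.Nonempty) :
    parentMaps K U ⊆ (U.powerset.filter Finset.Nonempty).biUnion fun J =>
      ((Fintype.piFinset fun i => if i ∈ J then K else {i}) ×ˢ parentMaps J (U \ J)).image
        fun q i => if i ∈ J then q.1 i else q.2 i := by
  intro p hp
  rw [mem_parentMaps] at hp
  obtain ⟨u₀, hu₀, hpu₀⟩ := hp.exists_mem_root hU
  obtain ⟨h1, h2, h, h3⟩ := hp
  rw [Finset.mem_biUnion]
  refine ⟨U.filter fun u => p u ∈ K, ?_, ?_⟩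
  · rw [Finset.mem_filter, Finset.mem_powerset]
    exact ⟨Finset.filter_subset _ _, u₀, Finset.mem_filter.2 ⟨hu₀, hpu₀⟩⟩
  · set J := U.filter fun u => p u ∈ K with hJ
    rw [Finset.mem_image]
    refine ⟨(fun i => if i ∈ J then p i else i, fun i => if i ∈ J then i else p i), ?_, ?_⟩
    · rw [Finset.mem_product, Fintype.mem_piFinset, mem_parentMaps]
      refine ⟨fun i => ?_, fun u hu => ?_, fun u hu => ?_, h, fun u hu => ?_⟩
      · by_cases hi : i ∈ J
        · simp only [hi, if_true]
          exact (Finset.mem_filter.1 hi).2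
        · simp [hi]
      · rw [Finset.mem_sdiff] at hu
        simp only [hu.2, if_false]
        rw [Finset.union_sdiff_of_subset (Finset.filter_subset _ _)]
        refine (Finset.mem_union.1 (h1 u hu.1)).resolve_left fun hK => hu.2 ?_
        exact Finset.mem_filter.2 ⟨hu.1, hK⟩
      · by_cases huJ : u ∈ J
        · simp [huJ]
        · simp only [huJ, if_false]
          exact h2 u fun huU => hu (Finset.mem_sdiff.2 ⟨huU, huJ⟩)
      · rw [Finset.mem_sdiff] at hu
        simp only [hu.2, if_false]
        exact h3 u hu.1
    · funext i
      by_cases hi : i ∈ J <;> simp [hi]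

theorem card_parentMaps_le_sum [Fintype α] {K U : Finset α} (hU : U.Nonempty) :
    (parentMaps K U).card ≤ ∑ J ∈ U.powerset with J.Nonempty,
      K.card ^ J.card * (parentMaps J (U \ J)).card := by
  refine (Finset.card_le_card (parentMaps_subset hU)).trans
    (Finset.card_biUnion_le.trans (Finset.sum_le_sum fun J _ => Finset.card_image_le.trans ?_))
  rw [Finset.card_product, Fintype.card_piFinset]
  refine Nat.mul_le_mul_right _ (le_of_eq ?_)
  rw [← Finset.prod_const, ← Finset.prod_subset (Finset.subset_univ J)]
  · exact Finset.prod_congr rfl fun i hi => by rw [if_pos hi]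
  · intro i _ hi
    rw [if_neg hi, Finset.card_singleton]

/-- Cayley's bound on the number of forests with prescribed roots. -/
theorem card_parentMaps_le [Fintype α] (K U : Finset α) :
    (K.card + U.card) * (parentMaps K U).card ≤ K.card * (K.card + U.card) ^ U.card := by
  induction hn : U.card using Nat.strong_induction_on generalizing K U with
  | _ n ih =>
  subst hn
  rcases U.eq_empty_or_nonempty with rfl | hU
  · simpa using Nat.mul_le_mul_left K.card (card_parentMaps_empty_le K)
  obtain ⟨m, hm⟩ := Nat.exists_eq_succ_of_ne_zero hU.card_pos.ne'
  rw [Nat.succ_eq_add_one] at hm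
  have key : (m + 1) * (parentMaps K U).card ≤ (m + 1) * (K.card * (K.card + (m + 1)) ^ m) := by
    rw [← mul_assoc, ← sum_powerset_card_mul_pow U _ m hm]
    refine (Nat.mul_le_mul_left _ (card_parentMaps_le_sum hU)).trans ?_
    rw [Finset.mul_sum]
    refine le_trans (Finset.sum_le_sum fun J hJ => ?_)
      (Finset.sum_le_sum_of_subset (Finset.filter_subset _ _))
    rw [Finset.mem_filter, Finset.mem_powerset] at hJ
    have hc : (U \ J).card = U.card - J.card := Finset.card_sdiff_of_subset hJ.1
    have hle := Finset.card_le_card hJ.1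
    have hpos := hJ.2.card_pos
    -- For every `J`, roots and non-roots of the smaller forest total |U| = m + 1, so one common
    -- factor m + 1 serves the whole sum.
    have h := ih (U \ J).card (by omega) J (U \ J) rfl
    rw [hc, Nat.add_sub_cancel' hle, hm] at h
    rw [hm]
    calc _ = K.card ^ J.card * ((m + 1) * (parentMaps J (U \ J)).card) := by ring
      _ ≤ K.card ^ J.card * (J.card * (m + 1) ^ (m + 1 - J.card)) := Nat.mul_le_mul_left _ h
      _ = _ := by ring
  have key' := Nat.le_of_mul_le_mul_left key (Nat.succ_pos m)
  rw [hm]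
  calc _ ≤ (K.card + (m + 1)) * (K.card * (K.card + (m + 1)) ^ m) := Nat.mul_le_mul_left _ key'
    _ = _ := by ring

end ParentMaps

/-! ### Labelled trees as parent maps. -/

section Trees

open SimpleGraph

theorem _root_.SimpleGraph.Connected.exists_adj_dist_lt {α : Type*} {G : SimpleGraph α} (hG : G.Connected)
    {r u : α} (hu : u ≠ r) : ∃ v, G.Adj u v ∧ G.dist v r < G.dist u r := by
  obtain ⟨w, hw⟩ := hG.exists_walk_length_eq_dist u r
  cases w with
  | nil => exact absurd rfl hu
  | cons h w =>
    refine ⟨_, h, ?_⟩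
    rw [← hw, SimpleGraph.Walk.length_cons]
    exact Nat.lt_succ_of_le (SimpleGraph.dist_le w)

theorem addEdges_bot_adj {n : ℕ} {S : Finset (Fin n × Fin n)} (hS : S ⊆ pairs n) {i j : Fin n} :
    (addEdges ⊥ S).Adj i j ↔ (i, j) ∈ S ∨ (j, i) ∈ S := by
  simp only [addEdges, bot_sup_eq, iSup_adj, edge_adj, exists_prop]
  constructor
  · rintro ⟨⟨a, b⟩, hp, ⟨rfl, rfl⟩ | ⟨rfl, rfl⟩, -⟩
    exacts [Or.inl hp, Or.inr hp]
  · rintro (h | h)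
    · exact ⟨_, h, Or.inl ⟨rfl, rfl⟩, (Finset.mem_filter.1 (hS h)).2.ne⟩
    · exact ⟨_, h, Or.inr ⟨rfl, rfl⟩, (Finset.mem_filter.1 (hS h)).2.ne'⟩

/-- The parent of `u` is a neighbour strictly closer to `r`, and the distance to `r` serves as
height. Two vertices giving the same edge would be each other's parent, contradicting the decrease
of the distance. -/
theorem exists_parentMap_of_isTree {n : ℕ} (r : Fin n) {S : Finset (Fin n × Fin n)}
    (hS : S ⊆ pairs n) (hT : (addEdges ⊥ S).IsTree) :
    ∃ p, IsParentMap {r} (Finset.univ.erase r) p ∧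
      Set.InjOn (fun u => (min u (p u), max u (p u))) (Finset.univ.erase r : Finset (Fin n)) ∧
      S = (Finset.univ.erase r).image fun u => (min u (p u), max u (p u)) := by
  classical
  have hex : ∀ u, ∃ v, (u ≠ r → (addEdges ⊥ S).Adj u v ∧
      (addEdges ⊥ S).dist v r < (addEdges ⊥ S).dist u r) ∧ (u = r → v = r) := by
    intro u
    by_cases hu : u = r
    · exact ⟨r, fun h => absurd hu h, fun _ => rfl⟩
    · obtain ⟨v, hv⟩ := hT.connected.exists_adj_dist_lt hu
      exact ⟨v, fun _ => hv, fun h => absurd h hu⟩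
  choose p hp hpr using hex
  have hinj : Set.InjOn (fun u => (min u (p u), max u (p u)))
      (Finset.univ.erase r : Finset (Fin n)) := by
    intro u hu v hv huv
    rw [Finset.mem_coe, Finset.mem_erase] at hu hv
    have h1 := (hp u hu.1).2
    have h2 := (hp v hv.1).2
    by_contra hne
    have hs : s(u, p u) = s(v, p v) := by
      have hmm : ∀ a b : Fin n, s(min a b, max a b) = s(a, b) := fun a b => by
        rcases le_total a b with h | h
        · rw [min_eq_left h, max_eq_right h]
        · rw [min_eq_right h, max_eq_left h, Sym2.eq_swap]
      rw [← hmm u, ← hmm v]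
      exact congrArg (fun q : Fin n × Fin n => s(q.1, q.2)) huv
    rw [Sym2.eq_iff] at hs
    rcases hs with ⟨h, -⟩ | ⟨h, h'⟩
    · exact hne h
    · rw [h', h] at h1
      exact absurd h1 (not_lt.2 h2.le)
  refine ⟨p, ⟨fun u _ => ?_, fun u hu => ?_, fun u => (addEdges ⊥ S).dist u r, fun u hu => ?_⟩,
    hinj, ?_⟩
  · by_cases h : p u = r <;> simp [h]
  · have hur : u = r := by simpa using hu
    rw [hpr u hur, hur]
  · exact (hp u (Finset.ne_of_mem_erase hu)).2
  · symm
    -- The parent edges lie in `S`, and there are n - 1 of them, as many as a tree has edges.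
    refine Finset.eq_of_subset_of_card_le ?_ ?_
    · intro e he
      obtain ⟨u, hu, rfl⟩ := Finset.mem_image.1 he
      have hadj := (hp u (Finset.ne_of_mem_erase hu)).1
      rcases (addEdges_bot_adj hS).1 hadj with h | h
      · have hlt : u < p u := (Finset.mem_filter.1 (hS h)).2
        rwa [min_eq_left hlt.le, max_eq_right hlt.le]
      · have hlt : p u < u := (Finset.mem_filter.1 (hS h)).2
        rwa [min_eq_right hlt.le, max_eq_left hlt.le]
    · rw [Finset.card_image_of_injOn hinj, Finset.card_erase_of_mem (Finset.mem_univ r),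
        Finset.card_univ, ← hT.card_edgeFinset, Nat.add_sub_cancel]
      refine Finset.card_le_card_of_injOn (fun e => s(e.1, e.2)) ?_ ?_
      · intro e he
        rw [Finset.mem_coe, mem_edgeFinset, mem_edgeSet, addEdges_bot_adj hS]
        exact Or.inl he
      · intro e he e' he' h
        have h1 : e.1 < e.2 := (Finset.mem_filter.1 (hS he)).2
        have h2 : e'.1 < e'.2 := (Finset.mem_filter.1 (hS he')).2
        rcases Sym2.eq_iff.1 h with ⟨h3, h4⟩ | ⟨h3, h4⟩
        · exact Prod.ext h3 h4
        · rw [h3, h4] at h1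
          exact absurd h1 (not_lt.2 h2.le)

theorem graphSum_isTree_le {n : ℕ} (r : Fin n) {W : Fin n → Fin n → ℝ}
    (hW : ∀ i j, 0 ≤ W i j) (hsymm : ∀ i j, W i j = W j i) :
    graphSum IsTree (fun e => W e.1 e.2) ⊥ (pairs n) ≤
      ∑ p ∈ parentMaps {r} (Finset.univ.erase r), ∏ u ∈ Finset.univ.erase r, W u (p u) := by
  classical
  rw [graphSum_eq_sum_filter]
  have hex : ∀ S : Finset (Fin n × Fin n), ∃ p : Fin n → Fin n,
      S ∈ (pairs n).powerset.filter (fun S => (addEdges ⊥ S).IsTree) →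
      IsParentMap {r} (Finset.univ.erase r) p ∧
      Set.InjOn (fun u => (min u (p u), max u (p u))) (Finset.univ.erase r : Finset (Fin n)) ∧
      S = (Finset.univ.erase r).image fun u => (min u (p u), max u (p u)) := by
    intro S
    by_cases hS : S ∈ (pairs n).powerset.filter (fun S => (addEdges ⊥ S).IsTree)
    · have h := Finset.mem_filter.1 hS
      obtain ⟨p, hp⟩ := exists_parentMap_of_isTree r (Finset.mem_powerset.1 h.1) h.2
      exact ⟨p, fun _ => hp⟩
    · exact ⟨id, fun h => absurd h hS⟩
  choose P hP using hex
  calc _ = ∑ S ∈ (pairs n).powerset.filter (fun S => (addEdges ⊥ S).IsTree),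
        ∏ u ∈ Finset.univ.erase r, W u (P S u) := by
        refine Finset.sum_congr rfl fun S hS => ?_
        obtain ⟨-, hinj, hSP⟩ := hP S hS
        conv_lhs => rw [hSP]
        rw [Finset.prod_image hinj]
        refine Finset.prod_congr rfl fun u _ => ?_
        rcases le_total u (P S u) with h | h
        · rw [min_eq_left h, max_eq_right h]
        · rw [min_eq_right h, max_eq_left h, hsymm]
    _ = ∑ p ∈ ((pairs n).powerset.filter (fun S => (addEdges ⊥ S).IsTree)).image P,
        ∏ u ∈ Finset.univ.erase r, W u (p u) := by
        rw [Finset.sum_image]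
        intro S hS S' hS' h
        rw [(hP S hS).2.2, (hP S' hS').2.2, h]
    _ ≤ _ := by
        refine Finset.sum_le_sum_of_subset_of_nonneg ?_ fun _ _ _ =>
          Finset.prod_nonneg fun _ _ => hW _ _
        intro p hp
        obtain ⟨S, hS, rfl⟩ := Finset.mem_image.1 hp
        exact mem_parentMaps.2 (hP S hS).1

end Trees

/-! ### Integrating a product over the edges of a tree. -/

section TreeIntegrals

open MeasureTheory

variable {ι E : Type*} [DecidableEq ι] [AddCommGroup E] [MeasurableSpace E] [MeasurableAdd₂ E]
  [MeasurableNeg E] {μ : Measure E} [SigmaFinite μ] [μ.IsAddRightInvariant]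

/-- Leaves are integrated out one at a time: the variable of a leaf occurs in a single factor, and
translation invariance makes its integral independent of the position of its parent. -/
theorem lmarginal_mul_prod_sub {ψ : E → ℝ≥0∞} (hψ : Measurable ψ) (p : ι → ι) (h : ι → ℕ)
    {U : Finset ι} (hU : ∀ u ∈ U, h (p u) < h u) {c : (ι → E) → ℝ≥0∞} (hc : Measurable c)
    (hcU : ∀ u ∈ U, ∀ x y, c (Function.update x u y) = c x) :
    lmarginal (fun _ => μ) U (fun x => c x * ∏ u ∈ U, ψ (x u - x (p u))) =
      fun x => c x * (∫⁻ y, ψ y ∂μ) ^ U.card := by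
  have := MeasurableSub₂.mk (G := E) (by
    simp only [sub_eq_add_neg]
    exact measurable_fst.add measurable_snd.neg)
  induction hn : U.card generalizing U c with
  | zero =>
    rw [Finset.card_eq_zero] at hn
    subst hn
    simp
  | succ n ih =>
    have hne : U.Nonempty := Finset.card_pos.1 (by omega)
    -- A vertex of maximal height is nobody's parent in `U`, hence a leaf.
    obtain ⟨v, hv, hmax⟩ := Finset.exists_max_image U h hne
    have hmeas : Measurable fun x : ι → E => c x * ∏ u ∈ U, ψ (x u - x (p u)) :=
      hc.mul (Finset.measurable_prod _ fun u _ =>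
        hψ.comp ((measurable_pi_apply u).sub (measurable_pi_apply (p u))))
    have hpv : ∀ u ∈ U, p u ≠ v := fun u hu huv => by
      have h1 := hU u hu
      rw [huv] at h1
      exact absurd h1 (not_lt.2 (hmax u hu))
    have hint : ∀ x : ι → E,
        ∫⁻ y, (c (Function.update x v y) *
          ∏ u ∈ U, ψ (Function.update x v y u - Function.update x v y (p u))) ∂μ =
        (c x * ∫⁻ y, ψ y ∂μ) * ∏ u ∈ U.erase v, ψ (x u - x (p u)) := by
      intro x
      have hprod : ∀ y, ∏ u ∈ U, ψ (Function.update x v y u - Function.update x v y (p u)) =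
          ψ (y - x (p v)) * ∏ u ∈ U.erase v, ψ (x u - x (p u)) := by
        intro y
        rw [← Finset.mul_prod_erase U _ hv, Function.update_self,
          Function.update_of_ne (hpv v hv)]
        congr 1
        refine Finset.prod_congr rfl fun u hu => ?_
        rw [Function.update_of_ne (Finset.ne_of_mem_erase hu),
          Function.update_of_ne (hpv u (Finset.mem_of_mem_erase hu))]
      simp only [hprod, hcU v hv]
      have hm : Measurable fun y => ψ (y - x (p v)) := hψ.comp (measurable_id.sub_const _)
      rw [lintegral_const_mul _ (hm.mul_const _), lintegral_mul_const _ hm,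
        lintegral_sub_right_eq_self ψ, mul_assoc]
    rw [lmarginal_erase' _ hmeas hv]
    simp only [hint]
    rw [ih (fun u hu => hU u (Finset.mem_of_mem_erase hu)) (hc.mul_const _)
      (fun u hu x y => by rw [hcU u (Finset.mem_of_mem_erase hu)])
      (by rw [Finset.card_erase_of_mem hv, hn, Nat.add_sub_cancel])]
    funext x
    rw [pow_succ', mul_assoc]

theorem lintegral_prod_parentMap_le [Fintype ι] {ψ : E → ℝ≥0∞} (hψ : Measurable ψ) {r : ι}
    {p : ι → ι} (hp : IsParentMap {r} (Finset.univ.erase r) p) {Λ : Set E}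
    (hΛ : MeasurableSet Λ) :
    ∫⁻ x in Set.univ.pi fun _ : ι => Λ, ∏ u ∈ Finset.univ.erase r, ψ (x u - x (p u))
        ∂(Measure.pi fun _ => μ) ≤
      μ Λ * (∫⁻ y, ψ y ∂μ) ^ (Fintype.card ι - 1) := by
  have := MeasurableSub₂.mk (G := E) (by
    simp only [sub_eq_add_neg]
    exact measurable_fst.add measurable_snd.neg)
  obtain ⟨-, -, h, hh⟩ := hp
  have hind : Measurable fun x : ι → E => Λ.indicator (1 : E → ℝ≥0∞) (x r) :=
    (measurable_one.indicator hΛ).comp (measurable_pi_apply r)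
  have hprod : Measurable fun x : ι → E => ∏ u ∈ Finset.univ.erase r, ψ (x u - x (p u)) :=
    Finset.measurable_prod _ fun u _ =>
      hψ.comp ((measurable_pi_apply u).sub (measurable_pi_apply (p u)))
  have hmul : Measurable fun x : ι → E => Λ.indicator (1 : E → ℝ≥0∞) (x r) *
      ∏ u ∈ Finset.univ.erase r, ψ (x u - x (p u)) := hind.mul hprod
  rw [← lintegral_indicator (MeasurableSet.univ_pi fun _ => hΛ)]
  -- Only the root is kept in Λ; the other particles are released to the whole space.
  calc _ ≤ ∫⁻ x, Λ.indicator (1 : E → ℝ≥0∞) (x r) *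
        ∏ u ∈ Finset.univ.erase r, ψ (x u - x (p u)) ∂(Measure.pi fun _ => μ) := by
        refine lintegral_mono fun x => ?_
        by_cases hx : x ∈ Set.univ.pi fun _ : ι => Λ
        · rw [Set.indicator_of_mem hx, Set.indicator_of_mem (hx r (Set.mem_univ r)), Pi.one_apply,
            one_mul]
        · rw [Set.indicator_of_notMem hx]
          exact zero_le
    _ = _ := by
        rw [lintegral_eq_lmarginal_univ (fun _ => (0 : E)),
          lmarginal_erase _ hmul (Finset.mem_univ r),
          lmarginal_mul_prod_sub hψ p h hh hind]
        · simp only [Function.update_self]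
          rw [lintegral_mul_const _ (measurable_one.indicator hΛ), lintegral_indicator_one hΛ,
            Finset.card_erase_of_mem (Finset.mem_univ r), Finset.card_univ]
        · intro u hu x y
          rw [Function.update_of_ne (Finset.ne_of_mem_erase hu).symm]

end TreeIntegrals

/-! ### Stability, integrability and measurability of the potential. -/

section Potentials

open MeasureTheory

theorem _root_.EReal.coe_finset_sum {ι : Type*} (s : Finset ι) (f : ι → ℝ) :
    ((∑ i ∈ s, f i : ℝ) : EReal) = ∑ i ∈ s, (f i : EReal) := by
  classical
  induction s using Finset.induction_on with
  | empty => simp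
  | insert i s hi ih => rw [Finset.sum_insert hi, Finset.sum_insert hi, EReal.coe_add, ih]

variable {d : ℕ} {V : ℝ≥0 → EReal} {a B : ℝ}

/-- The infimum is attained: for a finite energy e and N > 0, each admissible `B` satisfies -e/N ≤
`B`, and this closed condition passes to the infimum. -/
theorem IsStable.stableWith_stabilityConstant (hV : IsStable d V) :
    StableWith d V (stabilityConstant d V) := by
  have hne : {B : ℝ | StableWith d V B}.Nonempty := hV
  refine ⟨le_csInf hne fun B hB => hB.1, fun N x => ?_⟩
  obtain ⟨B₀, hB₀⟩ := hV
  have hall : ∀ B, StableWith d V B → ((-(B * N) : ℝ) : EReal) ≤ energy V x := fun B hB => hB.2 N x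
  generalize energy V x = e at hall ⊢
  induction e using EReal.rec with
  | bot => exact absurd (hall B₀ hB₀) (not_le.2 (EReal.bot_lt_coe _))
  | top => exact le_top
  | coe e =>
    rw [EReal.coe_le_coe_iff]
    rcases Nat.eq_zero_or_pos N with rfl | hN
    · simpa using EReal.coe_le_coe_iff.1 (hall B₀ hB₀)
    · have hN' : (0 : ℝ) < N := Nat.cast_pos.2 hN
      have h : -e / N ≤ stabilityConstant d V := le_csInf hne fun B hB => by
        have := EReal.coe_le_coe_iff.1 (hall B hB)
        rw [div_le_iff₀ hN']
        linarith
      rw [div_le_iff₀ hN'] at h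
      linarith

theorem sum_pairs_orderEmb {n m : ℕ} (e : Fin m ↪o Fin n) (S : Finset (Fin n))
    (he : ∀ i, i ∈ S ↔ ∃ k, e k = i) (F : Fin n × Fin n → ℝ) :
    ∑ p ∈ pairs n with p.1 ∈ S ∧ p.2 ∈ S, F p = ∑ q ∈ pairs m, F (e q.1, e q.2) := by
  symm
  refine Finset.sum_bij (fun q _ => (e q.1, e q.2)) ?_ ?_ ?_ ?_
  · intro q hq
    rw [pairs, Finset.mem_filter] at hq
    simp only [pairs, Finset.mem_filter, Finset.mem_univ, true_and]
    exact ⟨e.lt_iff_lt.2 hq.2, (he _).2 ⟨_, rfl⟩, (he _).2 ⟨_, rfl⟩⟩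
  · intro q _ q' _ h
    exact Prod.ext (e.injective (congrArg Prod.fst h)) (e.injective (congrArg Prod.snd h))
  · rintro ⟨i, j⟩ hp
    simp only [pairs, Finset.mem_filter, Finset.mem_univ, true_and] at hp
    obtain ⟨hlt, hi, hj⟩ := hp
    obtain ⟨k, rfl⟩ := (he _).1 hi
    obtain ⟨l, rfl⟩ := (he _).1 hj
    exact ⟨(k, l), Finset.mem_filter.2 ⟨Finset.mem_univ _, e.lt_iff_lt.1 hlt⟩, rfl⟩
  · intro _ _
    rfl

/-- Stability for the subconfiguration indexed by `S`, relabelled increasingly so that the pairs i <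
j correspond. Without hard overlaps every term is finite and the inequality descends to the reals.
-/
theorem StableWith.neg_mul_card_le (hB : StableWith d V B) (hbot : ∀ r, V r ≠ ⊥) {n : ℕ}
    (x : Fin n → Space d) (S : Finset (Fin n))
    (hS : ∀ p ∈ pairs n, p.1 ∈ S → p.2 ∈ S → V ‖x p.1 - x p.2‖₊ ≠ ⊤) :
    -(B * S.card) ≤ ∑ p ∈ pairs n with p.1 ∈ S ∧ p.2 ∈ S, (V ‖x p.1 - x p.2‖₊).toReal := by
  have h := hB.2 S.card (x ∘ S.orderEmbOfFin rfl)
  have hmem : ∀ i, i ∈ S ↔ ∃ k, S.orderEmbOfFin rfl k = i := fun i => by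
    rw [← Finset.mem_coe, ← Finset.range_orderEmbOfFin S rfl, Set.mem_range]
  rw [sum_pairs_orderEmb (S.orderEmbOfFin rfl) S hmem, ← EReal.coe_le_coe_iff,
    EReal.coe_finset_sum]
  refine h.trans_eq (Finset.sum_congr rfl fun q hq => ?_)
  rw [EReal.coe_toReal _ (hbot _)]
  · rfl
  · refine hS (S.orderEmbOfFin rfl q.1, S.orderEmbOfFin rfl q.2) ?_ ((hmem _).2 ⟨_, rfl⟩)
      ((hmem _).2 ⟨_, rfl⟩)
    rw [pairs, Finset.mem_filter] at hq ⊢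
    exact ⟨Finset.mem_univ _, (S.orderEmbOfFin rfl).lt_iff_lt.2 hq.2⟩

namespace IsPenrose

theorem ne_bot (hV : IsPenrose d V a) (r : ℝ≥0) : V r ≠ ⊥ := hV.admissible.isPairPotential.ne_bot r

theorem coe_toReal (hV : IsPenrose d V a) {r : ℝ≥0} (hr : a < r) : ((V r).toReal : EReal) = V r :=
  EReal.coe_toReal (ne_top_of_lt (hV.negative_tail r hr)) (hV.ne_bot r)

theorem toReal_neg (hV : IsPenrose d V a) {r : ℝ≥0} (hr : a < r) : (V r).toReal < 0 := by
  have := hV.negative_tail r hr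
  rw [← hV.coe_toReal hr] at this
  exact EReal.coe_neg'.1 this

theorem mayerFunction_of_le (hV : IsPenrose d V a) {β : ℝ} (hβ : 0 < β) {r : ℝ≥0} (hr : r ≤ a) :
    mayerFunction β V r = -1 := by
  rw [mayerFunction, hV.hard_core r hr, EReal.coe_mul_top_of_pos hβ, EReal.neg_top, EReal.exp_bot]
  simp

theorem mayerFunction_of_lt (hV : IsPenrose d V a) (β : ℝ) {r : ℝ≥0} (hr : a < r) :
    mayerFunction β V r = Real.exp (-(β * (V r).toReal)) - 1 := by
  rw [mayerFunction, ← hV.coe_toReal hr, ← EReal.coe_mul, ← EReal.coe_neg, EReal.exp_coe,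
    ENNReal.toReal_ofReal (Real.exp_nonneg _), EReal.toReal_coe]

theorem neg_two_mul_le (hV : IsPenrose d V a) (hB : StableWith d V B) (x : Space d)
    (hx : a < ‖x‖) : -(B * 2) ≤ (V ‖x‖₊).toReal := by
  have h := hB.2 2 ![x, 0]
  rw [energy, show pairs 2 = {(0, 1)} by decide, Finset.sum_singleton] at h
  simp only [Matrix.cons_val_zero, Matrix.cons_val_one, sub_zero] at h
  rw [← hV.coe_toReal (by simpa using hx), EReal.coe_le_coe_iff] at h
  exact_mod_cast h

/-- Two-particle stability gives |V| ≤ 2B beyond the core, which controls the bounded region up to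
`r₀`; temperedness controls the rest. -/
theorem tailIntegral_lt_top (hV : IsPenrose d V a) : tailIntegral d V a < ⊤ := by
  obtain ⟨B, hB⟩ := hV.admissible.stable
  obtain ⟨r₀, -, hr₀⟩ := hV.admissible.tempered
  -- The sphere |x| = a is set apart because V = +∞ there; it is a null set since a > 0.
  have hsub : {x : Space d | a ≤ ‖x‖} ⊆
      Metric.sphere 0 a ∪ ({x | a < ‖x‖} ∩ Metric.closedBall 0 r₀) ∪ {x | r₀ ≤ ‖x‖} := by
    intro x hx
    rcases le_total r₀ ‖x‖ with h | h
    · exact Or.inr h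
    · rcases (show a ≤ ‖x‖ from hx).eq_or_lt with h' | h'
      · exact Or.inl (Or.inl (by simp [← h']))
      · exact Or.inl (Or.inr ⟨h', by simpa using h⟩)
  have hmeas : MeasurableSet ({x : Space d | a < ‖x‖} ∩ Metric.closedBall 0 r₀) :=
    (measurableSet_lt measurable_const measurable_norm).inter Metric.isClosed_closedBall.measurableSet
  refine (lintegral_mono_set hsub).trans_lt ((lintegral_union_le _ _ _).trans_lt ?_)
  refine ENNReal.add_lt_top.2 ⟨(lintegral_union_le _ _ _).trans_lt (ENNReal.add_lt_top.2 ⟨?_, ?_⟩),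
    hr₀⟩
  · rw [setLIntegral_measure_zero _ _ (Measure.addHaar_sphere_of_ne_zero _ _ hV.radius_pos.ne')]
    exact ENNReal.zero_lt_top
  · refine lt_of_le_of_lt (setLIntegral_mono' (g := fun _ => ENNReal.ofReal (B * 2)) hmeas ?_) ?_
    · rintro x ⟨hx, -⟩
      have hx' : a < ((‖x‖₊ : ℝ≥0) : ℝ) := hx
      rw [← hV.coe_toReal hx', EReal.abs_def, abs_of_neg (hV.toReal_neg hx')]
      exact ENNReal.ofReal_le_ofReal (neg_le.1 (hV.neg_two_mul_le hB x hx))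
    · rw [setLIntegral_const]
      refine ENNReal.mul_lt_top ENNReal.ofReal_lt_top ?_
      exact (measure_mono Set.inter_subset_right).trans_lt measure_closedBall_lt_top

end IsPenrose

/-- The factor `1 - e^{-β|V(r)|}` of a pair at distance `r`. -/
def treeWeight (β : ℝ) (V : ℝ≥0 → EReal) (a : ℝ) (r : ℝ≥0) : ℝ :=
  if (r : ℝ) ≤ a then 1 else 1 - Real.exp (β * (V r).toReal)

theorem IsPenrose.treeWeight_nonneg (hV : IsPenrose d V a) {β : ℝ} (hβ : 0 < β) (r : ℝ≥0) :
    0 ≤ treeWeight β V a r := by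
  unfold treeWeight
  split_ifs with h
  · exact zero_le_one
  · rw [sub_nonneg, Real.exp_le_one_iff]
    exact mul_nonpos_of_nonneg_of_nonpos hβ.le (hV.toReal_neg (not_le.1 h)).le

theorem IsPenrose.aemeasurable_toReal (hV : IsPenrose d V a) :
    AEMeasurable (fun x : Space d => (V ‖x‖₊).toReal) volume :=
  hV.admissible.isPairPotential.aemeasurable.ereal_toReal

theorem measurableSet_norm_le (a : ℝ) : MeasurableSet {x : Space d | (‖x‖₊ : ℝ) ≤ a} :=
  measurableSet_le measurable_norm measurable_const

theorem IsPenrose.aemeasurable_treeWeight (hV : IsPenrose d V a) (β : ℝ) :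
    AEMeasurable (fun x : Space d => treeWeight β V a ‖x‖₊) volume := by
  have h1 : AEMeasurable (fun x : Space d => 1 - Real.exp (β * (V ‖x‖₊).toReal)) volume :=
    (Real.measurable_exp.comp_aemeasurable (hV.aemeasurable_toReal.const_mul β)).const_sub 1
  obtain ⟨g, hg, hfg⟩ := h1
  refine ⟨fun x => if (‖x‖₊ : ℝ) ≤ a then 1 else g x,
    Measurable.ite (measurableSet_norm_le a) measurable_const hg, ?_⟩
  filter_upwards [hfg] with x hx
  rw [treeWeight, hx]

theorem IsPenrose.aemeasurable_mayerFunction (hV : IsPenrose d V a) {β : ℝ} (hβ : 0 < β) :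
    AEMeasurable (fun x : Space d => mayerFunction β V ‖x‖₊) volume := by
  have h1 : AEMeasurable (fun x : Space d => Real.exp (-(β * (V ‖x‖₊).toReal)) - 1) volume :=
    (Real.measurable_exp.comp_aemeasurable (hV.aemeasurable_toReal.const_mul β).neg).sub_const 1
  obtain ⟨g, hg, hfg⟩ := h1
  refine ⟨fun x => if (‖x‖₊ : ℝ) ≤ a then -1 else g x,
    Measurable.ite (measurableSet_norm_le a) measurable_const hg, ?_⟩
  filter_upwards [hfg] with x hx
  split_ifs with h
  · exact hV.mayerFunction_of_le hβ h
  · rw [hV.mayerFunction_of_lt β (not_le.1 h), hx]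

theorem IsPenrose.lintegral_treeWeight_le (hV : IsPenrose d V a) {β : ℝ} (hβ : 0 < β) :
    ∫⁻ x : Space d, ENNReal.ofReal (treeWeight β V a ‖x‖₊) ≤
      volume (Metric.closedBall (0 : Space d) a) + ENNReal.ofReal β * tailIntegral d V a := by
  have hT : MeasurableSet {x : Space d | a ≤ ‖x‖} :=
    measurableSet_le measurable_const measurable_norm
  have hball : MeasurableSet (Metric.closedBall (0 : Space d) a) :=
    Metric.isClosed_closedBall.measurableSet
  rw [tailIntegral, ← lintegral_const_mul' _ _ ENNReal.ofReal_ne_top, ← lintegral_indicator hT,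
    ← lintegral_indicator_one hball, ← lintegral_add_left (measurable_one.indicator hball)]
  refine lintegral_mono fun x => ?_
  by_cases hx : ‖x‖ ≤ a
  · have h1 : treeWeight β V a ‖x‖₊ = 1 := if_pos hx
    rw [h1, Set.indicator_of_mem (show x ∈ Metric.closedBall 0 a by simpa using hx),
      ENNReal.ofReal_one]
    exact le_self_add
  · have hx' : a < ((‖x‖₊ : ℝ≥0) : ℝ) := not_le.1 hx
    have h1 : treeWeight β V a ‖x‖₊ = 1 - Real.exp (β * (V ‖x‖₊).toReal) := if_neg hx
    rw [h1, Set.indicator_of_mem (show x ∈ {x : Space d | a ≤ ‖x‖} from (not_le.1 hx).le)]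
    refine le_trans ?_ le_add_self
    rw [← hV.coe_toReal hx', EReal.abs_def, abs_of_neg (hV.toReal_neg hx'),
      ← ENNReal.ofReal_mul hβ.le, EReal.toReal_coe]
    refine ENNReal.ofReal_le_ofReal ?_
    have := Real.add_one_le_exp (β * (V ‖x‖₊).toReal)
    linarith

/-- Taking the value ∞ on a measurable null set gives a majorant valid at every point. The pointwise
tree bound thus survives the passage to a measurable weight, and the integral is unchanged. -/
theorem _root_.AEMeasurable.exists_measurable_ge {α : Type*} [MeasurableSpace α] {μ : Measure α}
    {f : α → ℝ≥0∞} (hf : AEMeasurable f μ) : ∃ g, Measurable g ∧ f ≤ g ∧ g =ᵐ[μ] f := by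
  classical
  set N := toMeasurable μ {x | f x ≠ hf.mk f x} with hN
  have hN0 : μ N = 0 := by rw [hN, measure_toMeasurable]; exact hf.ae_eq_mk
  refine ⟨fun x => if x ∈ N then ⊤ else hf.mk f x,
    Measurable.ite (measurableSet_toMeasurable _ _) measurable_const hf.measurable_mk,
    fun x => ?_, ?_⟩
  · by_cases hx : x ∈ N
    · simp [hx]
    · have : f x = hf.mk f x := by
        by_contra h
        exact hx (subset_toMeasurable _ _ h)
      simp [hx, ← this]
  · filter_upwards [measure_eq_zero_iff_ae_notMem.1 hN0, hf.ae_eq_mk] with x hx hx'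
    simp [hx, ← hx']

end Potentials

/-! ### The tree bound for the Ursell function, and its measurability. -/

section Ursell

open SimpleGraph MeasureTheory

theorem addEdges_filter_adj {n : ℕ} (g : SimpleGraph (Fin n))
    [DecidablePred fun p : Fin n × Fin n => g.Adj p.1 p.2] :
    addEdges ⊥ ((pairs n).filter fun p => g.Adj p.1 p.2) = g := by
  ext i j
  rw [addEdges_bot_adj (Finset.filter_subset _ _)]
  simp only [pairs, Finset.mem_filter, Finset.mem_univ, true_and]
  constructor
  · rintro (⟨-, h⟩ | ⟨-, h⟩)
    exacts [h, h.symm]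
  · intro h
    rcases lt_or_gt_of_ne h.ne with h' | h'
    exacts [Or.inl ⟨h', h⟩, Or.inr ⟨h', h.symm⟩]

theorem filter_adj_addEdges {n : ℕ} {S : Finset (Fin n × Fin n)} (hS : S ⊆ pairs n)
    [DecidablePred fun p : Fin n × Fin n => (addEdges ⊥ S).Adj p.1 p.2] :
    ((pairs n).filter fun p => (addEdges ⊥ S).Adj p.1 p.2) = S := by
  ext ⟨i, j⟩
  simp only [Finset.mem_filter, addEdges_bot_adj hS]
  constructor
  · rintro ⟨hij, h | h⟩
    · exact h
    · exact absurd (Finset.mem_filter.1 hij).2 (not_lt.2 (Finset.mem_filter.1 (hS h)).2.le)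
  · exact fun h => ⟨hS h, Or.inl h⟩

variable {d : ℕ} {V : ℝ≥0 → EReal} {a B : ℝ}

theorem ursell_eq_graphSum (β : ℝ) (V : ℝ≥0 → EReal) {n : ℕ} (x : Fin n → Space d) :
    ursell β V n x =
      graphSum Connected (fun p => mayerFunction β V ‖x p.1 - x p.2‖₊) ⊥ (pairs n) := by
  classical
  rw [ursell, graphSum_eq_sum_filter]
  refine Finset.sum_bij' (fun g _ => (pairs n).filter fun p => g.Adj p.1 p.2)
    (fun S _ => addEdges ⊥ S) ?_ ?_ ?_ ?_ ?_
  · intro g hg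
    rw [Finset.mem_filter, Finset.mem_powerset, addEdges_filter_adj]
    exact ⟨Finset.filter_subset _ _, (Finset.mem_filter.1 hg).2⟩
  · intro S hS
    exact Finset.mem_filter.2 ⟨Finset.mem_univ _, (Finset.mem_filter.1 hS).2⟩
  · intro g _
    exact addEdges_filter_adj g
  · intro S hS
    exact filter_adj_addEdges (Finset.mem_powerset.1 (Finset.mem_filter.1 hS).1)
  · intro g _
    exact Finset.prod_congr (by congr!) fun _ _ => rfl

theorem IsPenrose.abs_ursell_le (hV : IsPenrose d V a) (hB : StableWith d V B) {β : ℝ}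
    (hβ : 0 < β) {n : ℕ} (r : Fin n) (x : Fin n → Space d) :
    |ursell β V n x| ≤ Real.exp (β * B * n) *
      ∑ p ∈ parentMaps {r} (Finset.univ.erase r),
        ∏ u ∈ Finset.univ.erase r, treeWeight β V a ‖x u - x (p u)‖₊ := by
  classical
  set A := (pairs n).filter fun p => ¬ (‖x p.1 - x p.2‖₊ : ℝ) ≤ a with hA
  set H := (pairs n).filter fun p => (‖x p.1 - x p.2‖₊ : ℝ) ≤ a with hH
  have hAH : A ∪ H = pairs n := by rw [Finset.union_comm, Finset.filter_union_filter_not_eq]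
  have hmemA : ∀ e ∈ A, a < (‖x e.1 - x e.2‖₊ : ℝ) := fun e he =>
    not_le.1 (Finset.mem_filter.1 he).2
  have hmemH : ∀ e ∈ H, (‖x e.1 - x e.2‖₊ : ℝ) ≤ a := fun e he => (Finset.mem_filter.1 he).2
  have key := abs_graphSum_connected_le (A := A) (H := H)
    (u := fun e => β * (V ‖x e.1 - x e.2‖₊).toReal)
    (f := fun e => mayerFunction β V ‖x e.1 - x e.2‖₊)
    (w := fun e => treeWeight β V a ‖x e.1 - x e.2‖₊) (b := β * B)
    (Finset.disjoint_filter_filter_not _ _ _).symm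
    (fun e he => mul_nonpos_of_nonneg_of_nonpos hβ.le (hV.toReal_neg (hmemA e he)).le)
    (fun e he => hV.mayerFunction_of_lt β (hmemA e he))
    (fun e he => if_neg (not_le.2 (hmemA e he)))
    (fun e he => hV.mayerFunction_of_le hβ (hmemH e he))
    (fun e he => if_pos (hmemH e he)) ?_
  · rw [hAH, ← ursell_eq_graphSum, Fintype.card_fin] at key
    refine key.trans (mul_le_mul_of_nonneg_left ?_ (Real.exp_nonneg _))
    exact graphSum_isTree_le (W := fun i j => treeWeight β V a ‖x i - x j‖₊) r
      (fun i j => hV.treeWeight_nonneg hβ _)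
      (fun i j => by rw [← nnnorm_neg, neg_sub])
  · intro S hS
    have hSA : ∀ p ∈ pairs n, p.1 ∈ S → p.2 ∈ S → p ∈ A := fun p hp h1 h2 => by
      rw [← hAH, Finset.mem_union] at hp
      exact hp.resolve_right fun h => hS p h ⟨h1, h2⟩
    have h := hB.neg_mul_card_le hV.ne_bot x S fun p hp h1 h2 =>
      ne_top_of_lt (hV.negative_tail _ (hmemA p (hSA p hp h1 h2)))
    rw [← Finset.mul_sum]
    have hfil : A.filter (fun p => p.1 ∈ S ∧ p.2 ∈ S) =
        (pairs n).filter fun p => p.1 ∈ S ∧ p.2 ∈ S := by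
      ext p
      simp only [Finset.mem_filter]
      constructor
      · rintro ⟨h, h'⟩
        exact ⟨hAH ▸ Finset.mem_union_left H h, h'⟩
      · rintro ⟨h, h'⟩
        exact ⟨hSA p h h'.1 h'.2, h'⟩
    rw [hfil]
    calc -(β * B * S.card) = β * -(B * S.card) := by ring
      _ ≤ _ := mul_le_mul_of_nonneg_left h hβ.le

/-- The difference is a surjective linear map, so it pushes Lebesgue measure to a multiple of
Lebesgue measure. Null sets therefore pull back to null sets, as is needed because V(|x|) is only
a.e. measurable. -/
theorem quasiMeasurePreserving_sub {n : ℕ} {i j : Fin n} (hij : i ≠ j) :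
    Measure.QuasiMeasurePreserving (fun x : Fin n → Space d => x i - x j) volume volume := by
  have hm : Measurable fun x : Fin n → Space d => x i - x j :=
    (measurable_pi_apply i).sub (measurable_pi_apply j)
  refine ⟨hm, ?_⟩
  set L : (Fin n → Space d) →ₗ[ℝ] Space d := 
    LinearMap.proj (R := ℝ) (φ := fun _ => Space d) i -
      LinearMap.proj (R := ℝ) (φ := fun _ => Space d) j with hL
  have hsurj : Function.Surjective L := fun y => ⟨Function.update 0 i y, by
    simp [hL, Function.update_of_ne hij.symm]⟩
  obtain ⟨c, -, hc⟩ := L.exists_map_addHaar_eq_smul_addHaar volume volume hsurj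
  have : (fun x : Fin n → Space d => x i - x j) = L := rfl
  rw [this, hc]
  exact Measure.smul_absolutelyContinuous

theorem IsPenrose.aemeasurable_ursell (hV : IsPenrose d V a) {β : ℝ} (hβ : 0 < β) (n : ℕ) :
    AEMeasurable (ursell (d := d) β V n) volume := by
  classical
  unfold ursell
  refine Finset.aemeasurable_fun_sum _ fun g _ => Finset.aemeasurable_fun_prod _ fun p hp => ?_
  have hlt : p.1 < p.2 := (Finset.mem_filter.1 (Finset.mem_filter.1 hp).1).2
  exact (hV.aemeasurable_mayerFunction hβ).comp_quasiMeasurePreserving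
    (quasiMeasurePreserving_sub hlt.ne)

end Ursell

/-! ### Bounds on the Mayer coefficients and convergence of the series. -/

section MayerCoefficients

open MeasureTheory

variable {d : ℕ} {V : ℝ≥0 → EReal} {a B : ℝ}

theorem box_eq_preimage (c : Space d) (L : ℝ) :
    box c L = (WithLp.ofLp : Space d → Fin d → ℝ) ⁻¹' Set.Icc (fun i => c i) (fun i => c i + L) := by
  ext x
  simp only [box, Set.mem_ofPred_eq, Set.mem_preimage, Set.mem_Icc, Pi.le_def, forall_and]

theorem measurableSet_box (c : Space d) (L : ℝ) : MeasurableSet (box c L) := by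
  rw [box_eq_preimage]
  exact (PiLp.volume_preserving_ofLp (Fin d)).measurable measurableSet_Icc

theorem volume_box_lt_top (c : Space d) (L : ℝ) : volume (box c L) < ⊤ := by
  rw [box_eq_preimage, (PiLp.volume_preserving_ofLp (Fin d)).measure_preimage
    measurableSet_Icc.nullMeasurableSet]
  exact isCompact_Icc.measure_lt_top

theorem configurations_eq_pi (Λ : Set (Space d)) (n : ℕ) :
    configurations Λ n = Set.univ.pi fun _ => Λ := by
  ext x
  simp [configurations]

theorem IsPenrose.lintegral_ursell_le (hV : IsPenrose d V a) (hB : StableWith d V B) {β : ℝ}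
    (hβ : 0 < β) {n : ℕ} (r : Fin n) {Λ : Set (Space d)} (hΛ : MeasurableSet Λ) :
    ∫⁻ x in configurations Λ n, ‖ursell β V n x‖ₑ ≤
      ENNReal.ofReal (Real.exp (β * B * n)) *
        ((parentMaps {r} (Finset.univ.erase r)).card * (volume Λ *
          (volume (Metric.closedBall (0 : Space d) a) +
            ENNReal.ofReal β * tailIntegral d V a) ^ (n - 1))) := by
  obtain ⟨ψ, hψ, hle, hae⟩ := (hV.aemeasurable_treeWeight β).ennreal_ofReal.exists_measurable_ge
  have hmeas : ∀ p : Fin n → Fin n,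
      Measurable fun x : Fin n → Space d => ∏ u ∈ Finset.univ.erase r, ψ (x u - x (p u)) :=
    fun p => Finset.measurable_prod _ fun u _ =>
      hψ.comp ((measurable_pi_apply u).sub (measurable_pi_apply (p u)))
  have hpt : ∀ x : Fin n → Space d, ‖ursell β V n x‖ₑ ≤ ENNReal.ofReal (Real.exp (β * B * n)) *
      ∑ p ∈ parentMaps {r} (Finset.univ.erase r),
        ∏ u ∈ Finset.univ.erase r, ψ (x u - x (p u)) := by
    intro x
    rw [← ofReal_norm, Real.norm_eq_abs]
    refine (ENNReal.ofReal_le_ofReal (hV.abs_ursell_le hB hβ r x)).trans ?_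
    rw [ENNReal.ofReal_mul (Real.exp_nonneg _), ENNReal.ofReal_sum_of_nonneg fun p _ =>
      Finset.prod_nonneg fun u _ => hV.treeWeight_nonneg hβ _]
    refine mul_le_mul_right (Finset.sum_le_sum fun p _ => ?_) _
    rw [ENNReal.ofReal_prod_of_nonneg fun u _ => hV.treeWeight_nonneg hβ _]
    exact Finset.prod_le_prod' fun u _ => hle (x u - x (p u))
  refine (lintegral_mono hpt).trans ?_
  rw [lintegral_const_mul' _ _ ENNReal.ofReal_ne_top, lintegral_finsetSum _ fun p _ => hmeas p,
    ← nsmul_eq_mul]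
  refine mul_le_mul_right (Finset.sum_le_card_nsmul _ _ _ fun p hp => ?_) _
  rw [configurations_eq_pi]
  refine (lintegral_prod_parentMap_le (μ := volume) hψ (mem_parentMaps.1 hp) hΛ).trans ?_
  rw [Fintype.card_fin, lintegral_congr_ae hae]
  exact mul_le_mul_right (pow_le_pow_left' (hV.lintegral_treeWeight_le hβ) _) _

theorem card_parentMaps_singleton_le {n : ℕ} (r : Fin n) :
    ((parentMaps {r} (Finset.univ.erase r)).card : ℝ) ≤ (n : ℝ) ^ ((n : ℤ) - 2) := by
  have hn : 0 < n := r.pos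
  have hn' : (0 : ℝ) < n := Nat.cast_pos.2 hn
  have h := card_parentMaps_le {r} (Finset.univ.erase r)
  rw [Finset.card_erase_of_mem (Finset.mem_univ r), Finset.card_singleton, Finset.card_univ,
    Fintype.card_fin, Nat.add_sub_cancel' hn, one_mul] at h
  have h' : (n : ℝ) * (parentMaps {r} (Finset.univ.erase r)).card ≤ (n : ℝ) ^ (n - 1) := by
    exact_mod_cast h
  -- The exponent n - 2 is an integer one so that n = 1 gives 1^{-1} = 1.
  rw [show (n : ℤ) - 2 = ((n - 1 : ℕ) : ℤ) - 1 by omega, zpow_sub_one₀ hn'.ne', zpow_natCast,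
    ← div_eq_mul_inv, le_div_iff₀ hn', mul_comm]
  exact h'

theorem cStar_nonneg {β : ℝ} (hβ : 0 < β) : 0 ≤ cStar d V a β :=
  add_nonneg measureReal_nonneg (mul_nonneg hβ.le ENNReal.toReal_nonneg)

theorem IsPenrose.ofReal_cStar (hV : IsPenrose d V a) {β : ℝ} (hβ : 0 < β) :
    ENNReal.ofReal (cStar d V a β) =
      volume (Metric.closedBall (0 : Space d) a) + ENNReal.ofReal β * tailIntegral d V a := by
  rw [cStar, ENNReal.ofReal_add measureReal_nonneg (mul_nonneg hβ.le ENNReal.toReal_nonneg),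
    ENNReal.ofReal_mul hβ.le, ENNReal.ofReal_toReal hV.tailIntegral_lt_top.ne, Measure.real,
    ENNReal.ofReal_toReal measure_closedBall_lt_top.ne]

theorem IsPenrose.lintegral_ursell_box_le (hV : IsPenrose d V a) (hB : StableWith d V B) {β : ℝ}
    (hβ : 0 < β) {n : ℕ} (hn : 1 ≤ n) (c : Space d) (L : ℝ) :
    ∫⁻ x in configurations (box c L) n, ‖ursell β V n x‖ₑ ≤
      ENNReal.ofReal (Real.exp (β * B * n) * ((n : ℝ) ^ ((n : ℤ) - 2) *
        (volume.real (box c L) * cStar d V a β ^ (n - 1)))) := by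
  refine (hV.lintegral_ursell_le hB hβ ⟨0, hn⟩ (measurableSet_box c L)).trans ?_
  have hz : 0 ≤ (n : ℝ) ^ ((n : ℤ) - 2) := zpow_nonneg (Nat.cast_nonneg n) _
  rw [ENNReal.ofReal_mul (Real.exp_nonneg _), ENNReal.ofReal_mul hz,
    ENNReal.ofReal_mul measureReal_nonneg, ENNReal.ofReal_pow (cStar_nonneg hβ),
    hV.ofReal_cStar hβ, Measure.real, ENNReal.ofReal_toReal (volume_box_lt_top c L).ne]
  refine mul_le_mul_right (mul_le_mul_left ?_ _) _
  rw [← ENNReal.ofReal_natCast]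
  exact ENNReal.ofReal_le_ofReal (card_parentMaps_singleton_le _)

theorem IsPenrose.integrableOn_ursell (hV : IsPenrose d V a) {β : ℝ} (hβ : 0 < β) {n : ℕ}
    (hn : 1 ≤ n) (c : Space d) (L : ℝ) :
    IntegrableOn (ursell β V n) (configurations (box c L) n) volume := by
  obtain ⟨B, hB⟩ := hV.admissible.stable
  exact ⟨(hV.aemeasurable_ursell hβ n).aestronglyMeasurable.restrict,
    (hV.lintegral_ursell_box_le hB hβ hn c L).trans_lt ENNReal.ofReal_lt_top⟩

theorem IsPenrose.abs_mayerCoeff_le (hV : IsPenrose d V a) (hB : StableWith d V B) {β : ℝ}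
    (hβ : 0 < β) {n : ℕ} (hn : 1 ≤ n) (c : Space d) (L : ℝ) :
    |mayerCoeff β V (box c L) n| ≤ Real.exp (β * B * n) * (n : ℝ) ^ ((n : ℤ) - 2) *
      cStar d V a β ^ (n - 1) / (n.factorial : ℝ) := by
  have hz : 0 ≤ (n : ℝ) ^ ((n : ℤ) - 2) := zpow_nonneg (Nat.cast_nonneg n) _
  have hC : 0 ≤ cStar d V a β ^ (n - 1) := pow_nonneg (cStar_nonneg hβ) _
  have hint : |∫ x in configurations (box c L) n, ursell β V n x| ≤
      Real.exp (β * B * n) * ((n : ℝ) ^ ((n : ℤ) - 2) *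
        (volume.real (box c L) * cStar d V a β ^ (n - 1))) := by
    have h := (enorm_integral_le_lintegral_enorm _).trans
      (hV.lintegral_ursell_box_le hB hβ hn c L)
    rw [← ofReal_norm, Real.norm_eq_abs] at h
    refine (ENNReal.ofReal_le_ofReal_iff ?_).1 h
    exact mul_nonneg (Real.exp_nonneg _) (mul_nonneg hz (mul_nonneg measureReal_nonneg hC))
  -- An inequality suffices, and it also covers boxes of zero volume, where the inverse is 0.
  have hvol : 1 / volume.real (box c L) * volume.real (box c L) ≤ 1 := by
    rw [one_div]
    exact inv_mul_le_one
  have hv : 0 ≤ 1 / volume.real (box c L) := one_div_nonneg.2 measureReal_nonneg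
  have hf : (0 : ℝ) ≤ 1 / n.factorial := by positivity
  rw [mayerCoeff, abs_mul, abs_of_nonneg (mul_nonneg hv hf)]
  calc _ ≤ 1 / volume.real (box c L) * (1 / n.factorial) *
        (Real.exp (β * B * n) * ((n : ℝ) ^ ((n : ℤ) - 2) *
        (volume.real (box c L) * cStar d V a β ^ (n - 1)))) :=
        mul_le_mul_of_nonneg_left hint (mul_nonneg hv hf)
    _ = 1 / volume.real (box c L) * volume.real (box c L) *
        (Real.exp (β * B * n) * (n : ℝ) ^ ((n : ℤ) - 2) *
        cStar d V a β ^ (n - 1) / n.factorial) := by ring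
    _ ≤ _ := mul_le_of_le_one_left (div_nonneg (mul_nonneg
        (mul_nonneg (Real.exp_nonneg _) hz) hC) (Nat.cast_nonneg _)) hvol

/-- n^n/n! is one term of the exponential series of e^n; this produces the extra e in the radius of
convergence. -/
theorem zpow_sub_two_div_factorial_le (n : ℕ) :
    ((n + 1 : ℕ) : ℝ) ^ (((n + 1 : ℕ) : ℤ) - 2) / ((n + 1).factorial : ℝ) ≤ Real.exp (n + 1) := by
  have hpos : (1 : ℝ) ≤ ((n + 1 : ℕ) : ℝ) := by exact_mod_cast Nat.succ_pos n
  have h := Real.pow_div_factorial_le_exp (x := ((n + 1 : ℕ) : ℝ)) (Nat.cast_nonneg _) (n + 1)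
  rw [Nat.cast_add_one n] at h ⊢
  refine le_trans ?_ h
  refine div_le_div_of_nonneg_right ?_ (Nat.cast_nonneg _)
  rw [← zpow_natCast]
  refine zpow_le_zpow_right₀ (by exact_mod_cast hpos) (by omega)

theorem IsPenrose.summable_mayer (hV : IsPenrose d V a) (hB : StableWith d V B) {β : ℝ}
    (hβ : 0 < β) (c : Space d) (L : ℝ) {z : ℂ}
    (hz : ‖z‖ < 1 / (Real.exp (β * B + 1) * cStar d V a β)) :
    Summable fun n : ℕ => ‖(mayerCoeff β V (box c L) (n + 1) : ℂ) * z ^ (n + 1)‖ := by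
  have hC := cStar_nonneg (d := d) (V := V) (a := a) hβ
  -- If `cStar` were 0, the quotient in `hz` would be 0 by convention and no `z` could satisfy `hz`.
  have hCpos : 0 < Real.exp (β * B + 1) * cStar d V a β :=
    one_div_pos.1 ((norm_nonneg z).trans_lt hz)
  set q := Real.exp (β * B + 1) * cStar d V a β * ‖z‖ with hq
  have hq0 : 0 ≤ q := mul_nonneg hCpos.le (norm_nonneg z)
  have hq1 : q < 1 := by
    rw [lt_div_iff₀ hCpos, mul_comm] at hz
    exact hz
  refine Summable.of_nonneg_of_le (fun _ => norm_nonneg _) (fun n => ?_)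
    ((summable_geometric_of_lt_one hq0 hq1).mul_left (Real.exp (β * B + 1) * ‖z‖))
  rw [norm_mul, norm_pow, Complex.norm_real, Real.norm_eq_abs]
  have h1 := hV.abs_mayerCoeff_le hB hβ (Nat.succ_pos n) c L
  have h2 := zpow_sub_two_div_factorial_le n
  rw [Nat.succ_eq_add_one, Nat.add_sub_cancel] at h1
  calc _ ≤ Real.exp (β * B * (n + 1 : ℕ)) * ((n + 1 : ℕ) : ℝ) ^ (((n + 1 : ℕ) : ℤ) - 2) *
        cStar d V a β ^ n / ((n + 1).factorial : ℝ) * ‖z‖ ^ (n + 1) :=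
        mul_le_mul_of_nonneg_right h1 (pow_nonneg (norm_nonneg z) _)
    _ = ((n + 1 : ℕ) : ℝ) ^ (((n + 1 : ℕ) : ℤ) - 2) / ((n + 1).factorial : ℝ) *
        (Real.exp (β * B * (n + 1 : ℕ)) * cStar d V a β ^ n * ‖z‖ ^ (n + 1)) := by ring
    _ ≤ Real.exp (n + 1) *
        (Real.exp (β * B * (n + 1 : ℕ)) * cStar d V a β ^ n * ‖z‖ ^ (n + 1)) :=
        mul_le_mul_of_nonneg_right h2 (mul_nonneg (mul_nonneg (Real.exp_nonneg _)
          (pow_nonneg hC _)) (pow_nonneg (norm_nonneg z) _))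
    _ = (Real.exp (n + 1) * Real.exp (β * B * (n + 1 : ℕ))) *
        (cStar d V a β ^ n * ‖z‖ ^ (n + 1)) := by ring
    _ = Real.exp (β * B + 1) ^ (n + 1) * (cStar d V a β ^ n * ‖z‖ ^ (n + 1)) := by
        rw [← Real.exp_add, ← Real.exp_nat_mul]
        congr 2
        push_cast
        ring
    _ = _ := by rw [hq]; ring

end MayerCoefficients

end Gas

end

theorem theorem1 (d : ℕ) (V : ℝ≥0 → EReal) (a : ℝ) (hV : Gas.IsPenrose d V a)
    (β : ℝ) (hβ : 0 < β) :
    Gas.tailIntegral d V a < ⊤ ∧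
    ∀ (c : Gas.Space d) (L : ℝ), 0 < L →
      (∀ n : ℕ, 1 ≤ n →
        MeasureTheory.IntegrableOn (Gas.ursell β V n)
          (Gas.configurations (Gas.box c L) n) MeasureTheory.volume ∧
        |Gas.mayerCoeff β V (Gas.box c L) n| ≤
          Real.exp (β * Gas.stabilityConstant d V * n) * (n : ℝ) ^ ((n : ℤ) - 2) *
            Gas.cStar d V a β ^ (n - 1) / (n.factorial : ℝ)) ∧
      (∀ z : ℂ,
        ‖z‖ < 1 / (Real.exp (β * Gas.stabilityConstant d V + 1) * Gas.cStar d V a β) →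
        Summable fun n : ℕ =>
          ‖(Gas.mayerCoeff β V (Gas.box c L) (n + 1) : ℂ) * z ^ (n + 1)‖) := by
  have hB := hV.admissible.stable.stableWith_stabilityConstant
  exact ⟨hV.tailIntegral_lt_top, fun c L _ => ⟨fun n hn => ⟨hV.integrableOn_ursell hβ hn c L,
    hV.abs_mayerCoeff_le hB hβ hn c L⟩, fun z hz => hV.summable_mayer hB hβ c L hz⟩⟩
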